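/- Let $G$ be a finite group of order $n$ that is not cyclic of prime power order, where $1$ is counted as a prime power (so the trivial group is excluded as well). Let $\Gamma_G$ be the power graph of $G$: the simple graph with vertex set $G$ in which two distinct elements are adjacent if and only if one of them is a power of the other. An $L(2,1)$-labeling of a finite graph $\Gamma$ is a function $f$ from the vertices of $\Gamma$ to the nonnegative integers such that $|f(u)-f(v)|\ge 2$ whenever $u$ and $v$ are adjacent and $|f(u)-f(v)|\ge 1$ whenever $u$ and $v$ are at distance two; its span is the difference between its maximum and minimum values, and $\lambda(\Gamma)$ denotes the minimum span over all $L(2,1)$-labelings of $\Gamma$. Then $$\lambda(\Gamma_G)\le 2n-4,$$ with equality if and only if $G$ is isomorphic to $\mathbb{Z}_2\times\mathbb{Z}_2$ or to $\mathbb{Z}_{2q}$ for some odd prime $q$. -/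

import Mathlib

namespace LambdaNumber

/-- An `L(j,k)`-labeling of a simple graph: labels of adjacent vertices differ by at least `j`, and
labels of vertices at distance two differ by at least `k`. (A distance `Γ.dist u v` equal to `2`
is the length of an actual shortest path: the default value for unreachable vertices is `0`.) -/
def IsLabeling {V : Type*} (Γ : SimpleGraph V) (j k : ℕ) (f : V → ℕ) : Prop :=
  (∀ u v : V, Γ.Adj u v → (j : ℤ) ≤ |(f u : ℤ) - (f v : ℤ)|) ∧
  (∀ u v : V, Γ.dist u v = 2 → (k : ℤ) ≤ |(f u : ℤ) - (f v : ℤ)|)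

/-- The span of a labeling of a finite vertex set: its maximum value minus its minimum value. -/
noncomputable def span {V : Type*} [Finite V] (f : V → ℕ) : ℕ :=
  (⨆ v, f v) - (⨅ v, f v)

/-- The `L(j,k)`-labeling number of a finite graph: the minimum span of an `L(j,k)`-labeling. -/
noncomputable def labelingNumber {V : Type*} [Finite V] (Γ : SimpleGraph V) (j k : ℕ) : ℕ :=
  sInf {s : ℕ | ∃ f : V → ℕ, IsLabeling Γ j k f ∧ span f = s}

/-- The `λ`-number of a finite graph, that is, its `L(2,1)`-labeling number. -/
noncomputable def lambdaNumber {V : Type*} [Finite V] (Γ : SimpleGraph V) : ℕ :=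
  labelingNumber Γ 2 1

/-- The (undirected) power graph of a group: two distinct elements are adjacent if one of them is
a power of the other. -/
def powerGraph (G : Type*) [Group G] : SimpleGraph G where
  Adj x y := x ≠ y ∧ ((∃ m : ℕ, y = x ^ m) ∨ (∃ m : ℕ, x = y ^ m))
  symm := ⟨fun _ _ h => ⟨h.1.symm, h.2.symm⟩⟩
  loopless := ⟨fun _ h => h.1 rfl⟩

/-- The minimum defining the `L(j,k)`-labeling number is attained. -/
theorem exists_isLabeling_span_eq {V : Type*} [Finite V] (Γ : SimpleGraph V) (j k : ℕ) :
    ∃ f : V → ℕ, IsLabeling Γ j k f ∧ span f = labelingNumber Γ j k := by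
  have key : Set.Nonempty {s : ℕ | ∃ f : V → ℕ, IsLabeling Γ j k f ∧ span f = s} := by
    obtain ⟨n, ⟨e⟩⟩ := Finite.exists_equiv_fin V
    have hd : ∀ u v : V, u ≠ v →
        ((j + k : ℕ) : ℤ) ≤ |(((j + k) * (e u : ℕ) : ℕ) : ℤ) - (((j + k) * (e v : ℕ) : ℕ) : ℤ)| := by
      intro u v h
      have h1 : ((e u : ℕ) : ℤ) - ((e v : ℕ) : ℤ) ≠ 0 := by
        intro h0
        apply h
        apply e.injective
        apply Fin.ext
        omega
      have h2 := Int.one_le_abs h1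
      push_cast
      rw [← mul_sub, abs_mul, abs_of_nonneg (by positivity : (0 : ℤ) ≤ (j : ℤ) + k)]
      exact le_mul_of_one_le_right (by positivity) h2
    refine ⟨_, fun v => (j + k) * (e v : ℕ), ⟨fun u v h => ?_, fun u v h => ?_⟩, rfl⟩
    · exact le_trans (by push_cast; omega) (hd u v h.ne)
    · refine le_trans (by push_cast; omega) (hd u v ?_)
      rintro rfl
      simp at h
  exact Nat.sInf_mem key

end LambdaNumber

/-! The identity is adjacent to every other vertex, so a labeling is injective, and consecutive
labels can occur only at non-adjacent elements. Hence labels may be spaced by 2 throughout, and one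
unit is saved for every edge of the complement traversed by consecutive labels.

Upper bound: the hypothesis yields non-adjacent `x`, `y`. Passing to an inverse, or to a third
involution if both are involutions, gives a path on three vertices in the complement, hence `2n -
4`. A path on four vertices gives `2n - 5`, so equality forbids one. This forces every complement
edge to contain an involution. Two involutions then force a Klein four-group; a single one forces a
cyclic group of order `2q`.

Lower bound: for `ZMod (2 * q)` all complement edges pass through the unique involution, so at most
two units are saved; for order 4 a count of gaps suffices. -/

namespace LambdaNumber

/-! ### Bounds on `λ` from paths in the complement and from dominating vertices -/

section Labelings

variable {V : Type*}

theorem le_span_add [Finite V] (f : V → ℕ) (u v : V) : f u ≤ span f + f v := by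
  have h1 : f u ≤ ⨆ v, f v := le_ciSup (Set.finite_range f).bddAbove u
  have h2 : (⨅ v, f v) ≤ f v := ciInf_le (OrderBot.bddBelow _) v
  unfold span
  omega

theorem span_le_of_forall_le [Finite V] [Nonempty V] {f : V → ℕ} {M : ℕ} (h : ∀ v, f v ≤ M) :
    span f ≤ M :=
  (Nat.sub_le _ _).trans (ciSup_le h)

/-- A partial labeling of `s` by distinct values up to `M` extends to all vertices by using two
further values for every remaining vertex. -/
theorem lambdaNumber_le_of_partial [Finite V] [Nonempty V] (Γ : SimpleGraph V) (s : Finset V)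
    (g : V → ℕ) (M : ℕ) (hM : ∀ v ∈ s, g v ≤ M) (hinj : ∀ u ∈ s, ∀ v ∈ s, u ≠ v → g u ≠ g v)
    (hadj : ∀ u ∈ s, ∀ v ∈ s, Γ.Adj u v → (2 : ℤ) ≤ |(g u : ℤ) - (g v : ℤ)|) :
    lambdaNumber Γ + 2 * s.card ≤ M + 2 * Nat.card V := by
  classical
  have := Fintype.ofFinite V
  have hcard : (sᶜ).card + s.card = Nat.card V := by
    rw [Nat.card_eq_fintype_card, add_comm, Finset.card_add_card_compl]
  let e := (sᶜ).equivFin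
  let f : V → ℕ := fun v =>
    if h : v ∈ sᶜ then M + 2 + 2 * (e ⟨v, h⟩ : ℕ) else g v
  have hin : ∀ v ∈ s, f v = g v := fun v hv => dif_neg (by simpa using hv)
  have hout : ∀ v (h : v ∈ sᶜ), f v = M + 2 + 2 * (e ⟨v, h⟩ : ℕ) := fun v h => dif_pos h
  have hne : ∀ u v, u ≠ v → f u ≠ f v ∧ (Γ.Adj u v → (2 : ℤ) ≤ |(f u : ℤ) - (f v : ℤ)|) := by
    intro u v huv
    by_cases hu : u ∈ s <;> by_cases hv : v ∈ s
    · rw [hin u hu, hin v hv]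
      exact ⟨hinj u hu v hv huv, hadj u hu v hv⟩
    · rw [hin u hu, hout v (by simpa using hv)]
      have := hM u hu
      exact ⟨by omega, fun _ => le_abs.2 (Or.inr (by push_cast; omega))⟩
    · rw [hin v hv, hout u (by simpa using hu)]
      have := hM v hv
      exact ⟨by omega, fun _ => le_abs.2 (Or.inl (by push_cast; omega))⟩
    · rw [hout u (by simpa using hu), hout v (by simpa using hv)]
      have h : (e ⟨u, by simpa using hu⟩ : ℕ) ≠ (e ⟨v, by simpa using hv⟩ : ℕ) := fun h =>
        huv (congrArg Subtype.val (e.injective (Fin.ext h)))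
      refine ⟨by omega, fun _ => ?_⟩
      rcases Nat.lt_or_gt_of_ne h with h | h
      · exact le_abs.2 (Or.inr (by push_cast; omega))
      · exact le_abs.2 (Or.inl (by push_cast; omega))
  have hlab : IsLabeling Γ 2 1 f := by
    refine ⟨fun u v h => by exact_mod_cast (hne u v h.ne).2 h, fun u v h => ?_⟩
    have huv : u ≠ v := by
      rintro rfl
      simp at h
    have := (hne u v huv).1
    have h1 : (f u : ℤ) - (f v : ℤ) ≠ 0 := by omega
    exact_mod_cast Int.one_le_abs h1
  have hspan : span f ≤ M + 2 * (sᶜ).card := by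
    refine span_le_of_forall_le fun v => ?_
    by_cases hv : v ∈ s
    · rw [hin v hv]
      have := hM v hv
      omega
    · rw [hout v (by simpa using hv)]
      have := (e ⟨v, by simpa using hv⟩).isLt
      omega
  have hle : lambdaNumber Γ ≤ span f := Nat.sInf_le ⟨f, hlab, rfl⟩
  omega

theorem lambdaNumber_le_of_path_three [Finite V] (Γ : SimpleGraph V) {a b c : V} (hab : a ≠ b)
    (hac : a ≠ c) (hbc : b ≠ c) (nab : ¬ Γ.Adj a b) (nbc : ¬ Γ.Adj b c) :
    lambdaNumber Γ + 4 ≤ 2 * Nat.card V := by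
  classical
  have : Nonempty V := ⟨a⟩
  have hs : ({a, b, c} : Finset V).card = 3 := by simp [*]
  have h := lambdaNumber_le_of_partial Γ {a, b, c}
    (fun v => if v = a then 0 else if v = b then 1 else 2) 2
    (by intro v _; split_ifs <;> omega)
    (by simp [hab, hac, hbc, hab.symm, hac.symm, hbc.symm])
    (by simp [hab.symm, hac.symm, hbc.symm, nab, nbc, Γ.adj_comm b a,
          Γ.adj_comm c b])
  omega

theorem lambdaNumber_le_of_path_four [Finite V] (Γ : SimpleGraph V) {a b c d : V} (hab : a ≠ b)
    (hac : a ≠ c) (had : a ≠ d) (hbc : b ≠ c) (hbd : b ≠ d) (hcd : c ≠ d)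
    (nab : ¬ Γ.Adj a b) (nbc : ¬ Γ.Adj b c) (ncd : ¬ Γ.Adj c d) :
    lambdaNumber Γ + 5 ≤ 2 * Nat.card V := by
  classical
  have : Nonempty V := ⟨a⟩
  have hs : ({a, b, c, d} : Finset V).card = 4 := by simp [*]
  have h := lambdaNumber_le_of_partial Γ {a, b, c, d}
    (fun v => if v = a then 0 else if v = b then 1 else if v = c then 2 else 3) 3
    (by intro v _; split_ifs <;> omega)
    (by simp [hab, hac, had, hbc, hbd, hcd, hab.symm, hac.symm, had.symm, hbc.symm, hbd.symm,
          hcd.symm])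
    (by simp [hab.symm, hac.symm, had.symm, hbc.symm, hbd.symm, hcd.symm, nab, nbc, ncd,
          Γ.adj_comm b a, Γ.adj_comm c b, Γ.adj_comm d c])
  omega

theorem IsLabeling.injective_of_dominating {Γ : SimpleGraph V} {f : V → ℕ}
    (hf : IsLabeling Γ 2 1 f) {e : V} (he : ∀ v, v ≠ e → Γ.Adj e v) : Function.Injective f := by
  intro u v huv
  by_contra hne
  have h0 : |(f u : ℤ) - (f v : ℤ)| = 0 := by simp [huv]
  by_cases hadj : Γ.Adj u v
  · have := hf.1 u v hadj
    omega
  · have hu : u ≠ e := by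
      rintro rfl
      exact hadj (he v (Ne.symm hne))
    have hv : v ≠ e := by
      rintro rfl
      exact hadj (he u hne).symm
    let w : Γ.Walk u v := .cons (he u hu).symm (.cons (he v hv) .nil)
    have h2 : Γ.dist u v ≤ 2 := Γ.dist_le w
    have hpos : Γ.dist u v ≠ 0 := fun h => hne (w.reachable.dist_eq_zero_iff.1 h)
    have hone : Γ.dist u v ≠ 1 := fun h => hadj (SimpleGraph.dist_eq_one_iff_adj.1 h)
    have := hf.2 u v (by omega)
    omega

/-- If the vertices outside `t` have no vertex labeled by the next value, the span is at least
`2 * |V| - 2 - |t|`. -/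
theorem two_mul_card_le_span [Finite V] (f : V → ℕ) (hf : Function.Injective f) (t : Finset V)
    (ht : ∀ v ∉ t, ∀ w, f w ≠ f v + 1) : 2 * Nat.card V ≤ span f + 2 + t.card := by
  classical
  have := Fintype.ofFinite V
  rcases isEmpty_or_nonempty V with h | h
  · simp
  obtain ⟨m, hm⟩ := Finite.exists_min f
  have hsub : Finset.univ.image f ∪ (tᶜ).image (fun v => f v + 1) ⊆
      Finset.Icc (f m) (f m + span f + 1) := by
    -- Each vertex outside `t` wastes the integer after its label. The interval has `span f + 2`
    -- elements because the successor of the largest label is allowed.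
    intro i hi
    simp only [Finset.mem_union, Finset.mem_image, Finset.mem_univ, true_and] at hi
    rw [Finset.mem_Icc]
    rcases hi with ⟨v, rfl⟩ | ⟨v, _, rfl⟩ <;>
    · have := le_span_add f v m
      have := hm v
      omega
  have hdisj : Disjoint (Finset.univ.image f) ((tᶜ).image (fun v => f v + 1)) := by
    rw [Finset.disjoint_left]
    intro i hi hi'
    simp only [Finset.mem_image, Finset.mem_univ, true_and, Finset.mem_compl] at hi hi'
    obtain ⟨w, rfl⟩ := hi
    obtain ⟨v, hv, h⟩ := hi'
    exact ht v hv w h.symm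
  have h1 := Finset.card_le_card hsub
  rw [Finset.card_union_of_disjoint hdisj, Finset.card_image_of_injective _ hf,
    Finset.card_image_of_injective _ (fun a b h => hf (by simpa using h)), Nat.card_Icc,
    Finset.card_univ, ← Nat.card_eq_fintype_card] at h1
  have hcard : t.card + (tᶜ).card = Nat.card V := by
    rw [Nat.card_eq_fintype_card, Finset.card_add_card_compl]
  omega

theorem IsLabeling.not_adj_of_succ {Γ : SimpleGraph V} {f : V → ℕ} (hf : IsLabeling Γ 2 1 f)
    {v w : V} (h : f w = f v + 1) : ¬ Γ.Adj v w := by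
  intro hadj
  have := hf.1 v w hadj
  rw [h, Nat.cast_add, Nat.cast_one, sub_add_cancel_left] at this
  norm_num at this

/-- If `e` is dominating and `z` meets all edges of the complement, then `λ ≥ 2 * |V| - 4`. -/
theorem two_mul_card_le_lambdaNumber_of_cover [Finite V] (Γ : SimpleGraph V) {e z : V}
    (he : ∀ v, v ≠ e → Γ.Adj e v) (hz : ∀ u v, u ≠ v → ¬ Γ.Adj u v → u = z ∨ v = z) :
    2 * Nat.card V ≤ lambdaNumber Γ + 4 := by
  classical
  obtain ⟨f, hf, hs⟩ := exists_isLabeling_span_eq Γ 2 1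
  have hinj := hf.injective_of_dominating he
  have hs' : span f = lambdaNumber Γ := hs
  by_cases hp : ∃ p, f z = f p + 1
  · obtain ⟨p, hp⟩ := hp
    -- Consecutive labels form a complement edge, which contains `z`: the lower end is `z` itself or
    -- its predecessor `p`.
    have h := two_mul_card_le_span f hinj {z, p} fun v hv w hw => by
      simp only [Finset.mem_insert, Finset.mem_singleton, not_or] at hv
      have hvw : v ≠ w := by
        rintro rfl
        omega
      rcases hz v w hvw (hf.not_adj_of_succ hw) with h | rfl
      · exact hv.1 h
      · exact hv.2 (hinj (by omega))
    have := Finset.card_le_two (a := z) (b := p)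
    omega
  · have h := two_mul_card_le_span f hinj {z} fun v hv w hw => by
      have hvw : v ≠ w := by
        rintro rfl
        omega
      rcases hz v w hvw (hf.not_adj_of_succ hw) with h | rfl
      · exact hv (by simp [h])
      · exact hp ⟨v, hw⟩
    rw [Finset.card_singleton] at h
    omega

theorem card_le_lambdaNumber_of_dominating [Finite V] (Γ : SimpleGraph V) {e : V}
    (he : ∀ v, v ≠ e → Γ.Adj e v) (hV : 2 ≤ Nat.card V) : Nat.card V ≤ lambdaNumber Γ := by
  classical
  have := Fintype.ofFinite V
  obtain ⟨f, hf, hs⟩ := exists_isLabeling_span_eq Γ 2 1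
  have hinj := hf.injective_of_dominating he
  have hs' : span f = lambdaNumber Γ := hs
  have hne : (Finset.univ.erase e).Nonempty := by
    rw [← Finset.card_pos, Finset.card_erase_of_mem (Finset.mem_univ e), Finset.card_univ,
      ← Nat.card_eq_fintype_card]
    omega
  obtain ⟨m, hm, hmax⟩ := Finset.exists_max_image _ f hne
  have hme : m ≠ e := Finset.ne_of_mem_erase hm
  -- Two vertices have no successor: `e`, being dominating, and `m`, which has the top label apart
  -- from `e`.
  have h := two_mul_card_le_span f hinj ({e, m} : Finset V)ᶜ fun v hv w hw => by
    have hwv : w ≠ v := by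
      rintro rfl
      omega
    have hnadj := hf.not_adj_of_succ hw
    simp only [Finset.mem_compl, Finset.mem_insert, Finset.mem_singleton, not_not] at hv
    rcases hv with rfl | rfl
    · exact hnadj (he w hwv)
    · by_cases hwe : w = e
      · subst hwe
        exact hnadj (he v hme).symm
      · have := hmax w (by simp [hwe])
        omega
  rw [Finset.card_compl, Finset.card_pair hme.symm, ← Nat.card_eq_fintype_card] at h
  omega

end Labelings

/-! ### Adjacency and involutions in power graphs -/

section PowerGraph

variable {G : Type*} [Group G]

/-- In a cyclic group `u ^ m = 1` has at most `m` solutions; for `m = orderOf y` the powers of `y`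
already exhaust them. -/
theorem mem_zpowers_of_orderOf_dvd [Finite G] [IsCyclic G] {x y : G}
    (h : orderOf x ∣ orderOf y) : x ∈ Subgroup.zpowers y := by
  classical
  have := Fintype.ofFinite G
  have hsub : (Subgroup.zpowers y : Set G).toFinset ⊆
      Finset.univ.filter fun u : G => u ^ orderOf y = 1 := by
    intro u hu
    rw [Set.mem_toFinset, SetLike.mem_coe] at hu
    rw [Finset.mem_filter]
    exact ⟨Finset.mem_univ _, orderOf_dvd_iff_pow_eq_one.1 (orderOf_dvd_of_mem_zpowers hu)⟩
  have heq := Finset.eq_of_subset_of_card_le hsub <| by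
    refine (IsCyclic.card_pow_eq_one_le (orderOf_pos y)).trans (le_of_eq ?_)
    rw [Set.toFinset_card, ← Nat.card_eq_fintype_card]
    exact (Nat.card_zpowers y).symm
  have hx : x ∈ Finset.univ.filter fun u : G => u ^ orderOf y = 1 := by
    rw [Finset.mem_filter]
    exact ⟨Finset.mem_univ _, orderOf_dvd_iff_pow_eq_one.1 h⟩
  rw [← heq, Set.mem_toFinset] at hx
  exact hx

theorem eq_of_mem_zpowers_of_orderOf_eq_two {x y : G} (hx : orderOf x = 2) (hy : orderOf y = 2)
    (h : y ∈ Subgroup.zpowers x) : y = x := by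
  classical
  have hfin : IsOfFinOrder x := orderOf_pos_iff.1 (by omega)
  obtain ⟨m, hm, rfl⟩ := Finset.mem_image.1 (hfin.mem_zpowers_iff_mem_range_orderOf.1 h)
  rw [hx, Finset.mem_range] at hm
  interval_cases m
  · simp at hy
  · simp

theorem IsCyclic.eq_of_orderOf_eq_two [Finite G] [IsCyclic G] {x y : G} (hx : orderOf x = 2)
    (hy : orderOf y = 2) : x = y :=
  eq_of_mem_zpowers_of_orderOf_eq_two hy hx (mem_zpowers_of_orderOf_dvd (by rw [hx, hy]))

theorem eq_of_mem_zpowers_of_mem_zpowers [Finite G] {g x y : G} (hx : orderOf x = 2)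
    (hy : orderOf y = 2) (hxg : x ∈ Subgroup.zpowers g) (hyg : y ∈ Subgroup.zpowers g) :
    x = y := by
  have h := IsCyclic.eq_of_orderOf_eq_two (G := Subgroup.zpowers g) (x := ⟨x, hxg⟩)
    (y := ⟨y, hyg⟩) (by rw [Subgroup.orderOf_mk, hx]) (by rw [Subgroup.orderOf_mk, hy])
  exact congrArg Subtype.val h

theorem powerGraph_adj_iff [Finite G] {x y : G} : (powerGraph G).Adj x y ↔
    x ≠ y ∧ (y ∈ Subgroup.zpowers x ∨ x ∈ Subgroup.zpowers y) := by
  rw [← mem_powers_iff_mem_zpowers, ← mem_powers_iff_mem_zpowers, Submonoid.mem_powers_iff,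
    Submonoid.mem_powers_iff]
  simp only [powerGraph, eq_comm]

theorem powerGraph_adj_one {x : G} (hx : x ≠ 1) : (powerGraph G).Adj 1 x :=
  ⟨hx.symm, Or.inr ⟨0, (pow_zero x).symm⟩⟩

theorem inv_ne_self {x : G} (h1 : x ≠ 1) (h2 : orderOf x ≠ 2) : x⁻¹ ≠ x := by
  intro h
  refine h2 (orderOf_eq_prime ?_ h1)
  rw [pow_two]
  nth_rw 1 [← h]
  exact inv_mul_cancel x

theorem isCyclic_of_forall_mem_zpowers_or [Finite G]
    (h : ∀ x y : G, y ∈ Subgroup.zpowers x ∨ x ∈ Subgroup.zpowers y) : IsCyclic G := by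
  obtain ⟨g, hg⟩ := Finite.exists_max (orderOf : G → ℕ)
  suffices hgen : ∀ y, y ∈ Subgroup.zpowers g from ⟨g, hgen⟩
  refine fun y => (h g y).elim id fun hy => ?_
  have hle : Subgroup.zpowers g ≤ Subgroup.zpowers y := by rwa [Subgroup.zpowers_le]
  have heq := Subgroup.eq_of_le_of_card_ge hle (by simpa only [Nat.card_zpowers] using hg y)
  rw [heq]
  exact Subgroup.mem_zpowers y

theorem exists_not_adj [Finite G]
    (hG : ¬ (IsCyclic G ∧ ∃ p k : ℕ, p.Prime ∧ Nat.card G = p ^ k)) :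
    ∃ x y : G, x ≠ y ∧ ¬ (powerGraph G).Adj x y := by
  by_contra! hcon
  have h : ∀ x y : G, y ∈ Subgroup.zpowers x ∨ x ∈ Subgroup.zpowers y := by
    intro x y
    by_cases hxy : x = y
    · exact Or.inl (hxy ▸ Subgroup.mem_zpowers x)
    · exact (powerGraph_adj_iff.1 (hcon x y hxy)).2
  refine hG ⟨isCyclic_of_forall_mem_zpowers_or h, ?_⟩
  by_cases h1 : Nat.card G = 1
  · exact ⟨2, 0, Nat.prime_two, by simpa using h1⟩
  have hp := Nat.minFac_prime h1
  refine ⟨_, _, hp, Nat.eq_prime_pow_of_unique_prime_dvd Nat.card_pos.ne' fun {q} hq hqG => ?_⟩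
  have := Fact.mk hp
  have := Fact.mk hq
  obtain ⟨x, hx⟩ := exists_prime_orderOf_dvd_card' (G := G) _ (Nat.minFac_dvd (Nat.card G))
  obtain ⟨y, hy⟩ := exists_prime_orderOf_dvd_card' (G := G) q hqG
  rcases h x y with h | h
  · have := orderOf_dvd_of_mem_zpowers h
    rw [hx, hy] at this
    exact (Nat.prime_dvd_prime_iff_eq hq hp).1 this
  · have := orderOf_dvd_of_mem_zpowers h
    rw [hx, hy] at this
    exact ((Nat.prime_dvd_prime_iff_eq hp hq).1 this).symm

theorem not_adj_of_orderOf_eq_two [Finite G] {x y : G} (hx : orderOf x = 2) (hy : orderOf y = 2) :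
    ¬ (powerGraph G).Adj x y := by
  rw [powerGraph_adj_iff]
  rintro ⟨hne, h | h⟩
  · exact hne (eq_of_mem_zpowers_of_orderOf_eq_two hx hy h).symm
  · exact hne (eq_of_mem_zpowers_of_orderOf_eq_two hy hx h)

theorem ne_one_of_not_adj {x y : G} (hne : x ≠ y) (h : ¬ (powerGraph G).Adj x y) :
    x ≠ 1 ∧ y ≠ 1 := by
  constructor
  · rintro rfl
    exact h (powerGraph_adj_one hne.symm)
  · rintro rfl
    exact h (powerGraph_adj_one hne).symm

theorem not_adj_inv_right [Finite G] {x y : G} (hne : x ≠ y) (h : ¬ (powerGraph G).Adj x y) :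
    x ≠ y⁻¹ ∧ ¬ (powerGraph G).Adj x y⁻¹ := by
  simp only [powerGraph_adj_iff, not_and, not_or, Subgroup.zpowers_inv, inv_mem_iff] at h ⊢
  refine ⟨?_, fun _ => h hne⟩
  rintro rfl
  exact (h hne).2 (inv_mem (Subgroup.mem_zpowers y))

theorem not_adj_inv_left [Finite G] {x y : G} (hne : x ≠ y) (h : ¬ (powerGraph G).Adj x y) :
    x⁻¹ ≠ y ∧ ¬ (powerGraph G).Adj x⁻¹ y := by
  have := not_adj_inv_right hne.symm fun h' => h h'.symm
  exact ⟨this.1.symm, fun h' => this.2 h'.symm⟩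

/-- The product serves if `x` and `y` commute, and the conjugate of `y` by `x` otherwise. -/
theorem exists_third_of_orderOf_eq_two {x y : G} (hx : orderOf x = 2) (hy : orderOf y = 2)
    (hne : x ≠ y) : ∃ z : G, orderOf z = 2 ∧ z ≠ x ∧ z ≠ y := by
  obtain ⟨hx2, hx1⟩ := orderOf_eq_prime_iff.1 hx
  obtain ⟨hy2, hy1⟩ := orderOf_eq_prime_iff.1 hy
  rw [pow_two] at hx2 hy2
  by_cases hc : x * y = y * x
  · refine ⟨x * y, orderOf_eq_prime ?_ ?_, by simpa using hy1, by simpa using hx1⟩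
    · rw [pow_two, mul_assoc, hc, ← mul_assoc y y x, hy2, one_mul, hx2]
    · intro h
      exact hne (by rw [← inv_eq_of_mul_eq_one_right hx2, inv_eq_of_mul_eq_one_right h])
  · have hinv : x⁻¹ = x := inv_eq_of_mul_eq_one_right hx2
    refine ⟨x * y * x⁻¹, ?_, ?_, ?_⟩
    · rw [← MulAut.conj_apply, MulEquiv.orderOf_eq, hy]
    · intro h
      rw [mul_inv_eq_iff_eq_mul] at h
      exact hne (mul_left_cancel h).symm
    · rwa [Ne, mul_inv_eq_iff_eq_mul]

/-! ### Upper bounds and the groups attaining equality -/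

theorem lambdaNumber_powerGraph_add_four_le [Finite G]
    (hG : ¬ (IsCyclic G ∧ ∃ p k : ℕ, p.Prime ∧ Nat.card G = p ^ k)) :
    lambdaNumber (powerGraph G) + 4 ≤ 2 * Nat.card G := by
  obtain ⟨x, y, hne, h⟩ := exists_not_adj hG
  obtain ⟨hx1, hy1⟩ := ne_one_of_not_adj hne h
  have h' : ¬ (powerGraph G).Adj y x := fun h' => h h'.symm
  by_cases hx : orderOf x = 2
  · by_cases hy : orderOf y = 2
    · obtain ⟨z, hz, hzx, hzy⟩ := exists_third_of_orderOf_eq_two hx hy hne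
      exact lambdaNumber_le_of_path_three _ hne hzx.symm hzy.symm h
        (not_adj_of_orderOf_eq_two hy hz)
    · have hi := not_adj_inv_right hne h
      exact lambdaNumber_le_of_path_three _ hne.symm (inv_ne_self hy1 hy).symm hi.1 h' hi.2
  · have hi := not_adj_inv_right hne.symm h'
    exact lambdaNumber_le_of_path_three _ hne (inv_ne_self hx1 hx).symm hi.1 h hi.2

/-- The complement contains the path `x, y, x⁻¹, y⁻¹`. -/
theorem lambdaNumber_powerGraph_add_five_le_of_not_adj [Finite G] {x y : G} (hne : x ≠ y)
    (h : ¬ (powerGraph G).Adj x y) (hx : orderOf x ≠ 2) (hy : orderOf y ≠ 2) :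
    lambdaNumber (powerGraph G) + 5 ≤ 2 * Nat.card G := by
  obtain ⟨hx1, hy1⟩ := ne_one_of_not_adj hne h
  have hl := not_adj_inv_left hne h
  have hr := not_adj_inv_right hne h
  have hlr := not_adj_inv_right hl.1 hl.2
  exact lambdaNumber_le_of_path_four _ hne (inv_ne_self hx1 hx).symm hr.1 hl.1.symm
    (inv_ne_self hy1 hy).symm hlr.1 h (fun h' => hl.2 h'.symm) hlr.2

theorem lambdaNumber_powerGraph_add_five_le_of_orderOf_eq_two [Finite G] {x y z g : G}
    (hx : orderOf x = 2) (hy : orderOf y = 2) (hz : orderOf z = 2) (hxy : x ≠ y) (hxz : x ≠ z)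
    (hyz : y ≠ z) (hg1 : g ≠ 1) (hgx : g ≠ x) (hgy : g ≠ y) (hgz : g ≠ z) :
    lambdaNumber (powerGraph G) + 5 ≤ 2 * Nat.card G := by
  -- An involution adjacent to `g` lies in the cyclic group `zpowers g`, which has at most one. So
  -- `g` can end a path through the three involutions.
  have key : ∀ a b : G, orderOf a = 2 → orderOf b = 2 → a ≠ b → (powerGraph G).Adj a g →
      ¬ (powerGraph G).Adj b g := by
    intro a b ha hb hab hag hbg
    have hgen : ∀ c : G, orderOf c = 2 → (powerGraph G).Adj c g → c ∈ Subgroup.zpowers g := by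
      intro c hc hcg
      rw [powerGraph_adj_iff] at hcg
      refine hcg.2.elim (fun h => ?_) id
      have hd := orderOf_dvd_of_mem_zpowers h
      rw [hc, Nat.dvd_prime Nat.prime_two, orderOf_eq_one_iff] at hd
      exact absurd (eq_of_mem_zpowers_of_orderOf_eq_two hc (hd.resolve_left hg1) h).symm hcg.1
    exact hab (eq_of_mem_zpowers_of_mem_zpowers ha hb (hgen a ha hag) (hgen b hb hbg))
  by_cases h : (powerGraph G).Adj z g
  · exact lambdaNumber_le_of_path_four _ hxz hxy hgx.symm hyz.symm hgz.symm hgy.symm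
      (not_adj_of_orderOf_eq_two hx hz) (not_adj_of_orderOf_eq_two hz hy)
      (key z y hz hy hyz.symm h)
  · exact lambdaNumber_le_of_path_four _ hxy hxz hgx.symm hyz hgy.symm hgz.symm
      (not_adj_of_orderOf_eq_two hx hy) (not_adj_of_orderOf_eq_two hy hz) h

theorem isKleinFour_of_orderOf_eq_two {x y z : G}
    (hx : orderOf x = 2) (hy : orderOf y = 2) (hz : orderOf z = 2) (hxy : x ≠ y) (hxz : x ≠ z)
    (hyz : y ≠ z) (h : ∀ g : G, g = 1 ∨ g = x ∨ g = y ∨ g = z) : IsKleinFour G := by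
  classical
  obtain ⟨hx2, hx1⟩ := orderOf_eq_prime_iff.1 hx
  obtain ⟨hy2, hy1⟩ := orderOf_eq_prime_iff.1 hy
  obtain ⟨hz2, hz1⟩ := orderOf_eq_prime_iff.1 hz
  constructor
  · have hu : (Set.univ : Set G) = (({1, x, y, z} : Finset G) : Set G) := by
      ext g
      simpa using h g
    rw [← Set.ncard_univ, hu, Set.ncard_coe_finset]
    simp [hxy, hxz, hyz, hx1.symm, hy1.symm, hz1.symm]
  · have hdvd : Monoid.exponent G ∣ 2 := Monoid.exponent_dvd_of_forall_pow_eq_one fun g => by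
      rcases h g with rfl | rfl | rfl | rfl
      · exact one_pow 2
      all_goals assumption
    refine (Nat.dvd_prime Nat.prime_two).1 hdvd |>.resolve_left fun h1 => hx1 ?_
    simpa [h1] using Monoid.pow_exponent_eq_one x

/-- A finite group with a single involution `x`, not adjacent to some `y`, such that all edges of
the complement of the power graph contain `x`, is cyclic of order `2q`. -/
theorem exists_mulEquiv_of_unique_orderOf_eq_two [Finite G] {x y : G} (hx : orderOf x = 2)
    (huniq : ∀ w : G, orderOf w = 2 → w = x) (hne : x ≠ y) (h : ¬ (powerGraph G).Adj x y)
    (hcov : ∀ u v : G, u ≠ v → ¬ (powerGraph G).Adj u v → orderOf u = 2 ∨ orderOf v = 2) :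
    ∃ q : ℕ, q.Prime ∧ Odd q ∧ Nonempty (G ≃* Multiplicative (ZMod (2 * q))) := by
  have hy1 : y ≠ 1 := (ne_one_of_not_adj hne h).2
  have hcomm : Commute x y := by
    have h1 : y * x * y⁻¹ = x := huniq _ (by rw [← MulAut.conj_apply, MulEquiv.orderOf_eq, hx])
    exact (mul_inv_eq_iff_eq_mul.1 h1).symm
  have hodd : Odd (orderOf y) := by
    rw [← Nat.not_even_iff_odd, even_iff_two_dvd]
    intro hdvd
    have h2 : orderOf (y ^ (orderOf y / 2)) = 2 := by
      rw [orderOf_pow_of_dvd, Nat.div_div_self hdvd (orderOf_pos y).ne']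
      · have := orderOf_pos y
        omega
      · exact Nat.div_dvd_of_dvd hdvd
    refine h (powerGraph_adj_iff.2 ⟨hne, Or.inr ?_⟩)
    rw [← huniq _ h2]
    exact Subgroup.npow_mem_zpowers y _
  have hxy : orderOf (x * y) = 2 * orderOf y := by
    rw [hcomm.orderOf_mul_eq_mul_orderOf_of_coprime, hx]
    rw [hx]
    exact Nat.coprime_two_left.2 hodd
  have hm1 : orderOf y ≠ 1 := by rwa [Ne, orderOf_eq_one_iff]
  have hm0 := orderOf_pos y
  obtain ⟨g, hg⟩ := Finite.exists_max (orderOf : G → ℕ)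
  have hg2 : orderOf g ≠ 2 := by
    have := hg (x * y)
    omega
  -- By `hcov`, `w` is comparable with `g`, and `g` has maximal order. Then `x`, as `(x * y) * y⁻¹`,
  -- also lies in `zpowers g`.
  have hmem : ∀ w : G, orderOf w ≠ 2 → w ∈ Subgroup.zpowers g := by
    intro w hw
    by_cases hwg : g = w
    · rw [← hwg]
      exact Subgroup.mem_zpowers g
    by_cases hadj : (powerGraph G).Adj g w
    · refine (powerGraph_adj_iff.1 hadj).2.elim id fun hgw => ?_
      have hle : Subgroup.zpowers g ≤ Subgroup.zpowers w := by rwa [Subgroup.zpowers_le]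
      have heq := Subgroup.eq_of_le_of_card_ge hle (by simpa only [Nat.card_zpowers] using hg w)
      rw [heq]
      exact Subgroup.mem_zpowers w
    · exact absurd (hcov g w hwg hadj) (by simp [hg2, hw])
  have hmx : x ∈ Subgroup.zpowers g := by
    have hy : y ∈ Subgroup.zpowers g := hmem y fun hy => hne (huniq y hy).symm
    have hxyg : x * y ∈ Subgroup.zpowers g := hmem _ (by omega)
    simpa using mul_mem hxyg (inv_mem hy)
  have hgen : ∀ w, w ∈ Subgroup.zpowers g := by
    intro w
    by_cases hw : orderOf w = 2
    · rwa [huniq w hw]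
    · exact hmem w hw
  have hcyc : IsCyclic G := ⟨g, hgen⟩
  have hcard : orderOf g = Nat.card G := orderOf_eq_card_of_forall_mem_zpowers hgen
  -- In a cyclic group `hcov` becomes a condition on divisors. A further prime factor `s` would
  -- violate it: by `4, q` if `s = 2`, by `2 * q, q * s` if `s` is odd.
  have hdiv : ∀ c d : ℕ, c ∣ Nat.card G → d ∣ Nat.card G → ¬ c ∣ d → ¬ d ∣ c → c = 2 ∨ d = 2 := by
    intro c d hc hd hcd hdc
    have hex : ∀ c, c ∣ Nat.card G → ∃ u : G, orderOf u = c := by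
      intro c hc
      refine ⟨g ^ (orderOf g / c), ?_⟩
      rw [← hcard] at hc
      have h0 : orderOf g / c ≠ 0 :=
        (Nat.div_pos (Nat.le_of_dvd (orderOf_pos g) hc)
          (Nat.pos_of_dvd_of_pos hc (orderOf_pos g))).ne'
      rw [orderOf_pow_of_dvd h0 (Nat.div_dvd_of_dvd hc), Nat.div_div_self hc (orderOf_pos g).ne']
    obtain ⟨u, rfl⟩ := hex c hc
    obtain ⟨v, rfl⟩ := hex d hd
    refine hcov u v ?_ ?_
    · rintro rfl
      exact hcd dvd_rfl
    · rw [powerGraph_adj_iff]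
      rintro ⟨-, h | h⟩
      · exact hdc (orderOf_dvd_of_mem_zpowers h)
      · exact hcd (orderOf_dvd_of_mem_zpowers h)
  have hq := Nat.minFac_prime hm1
  set q := (orderOf y).minFac
  have hqm : q ∣ orderOf y := Nat.minFac_dvd _
  have hqodd : Odd q := hodd.of_dvd_nat hqm
  have hq2 : q ≠ 2 := by
    intro h2
    rw [h2] at hqodd
    exact absurd hqodd (by decide)
  have hn : Nat.card G = 2 * q := by
    obtain ⟨r, hr⟩ : 2 * q ∣ Nat.card G :=
      (mul_dvd_mul_left 2 hqm).trans (hxy ▸ orderOf_dvd_natCard (x * y))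
    by_contra hne'
    have hr1 : r ≠ 1 := by
      rintro rfl
      exact hne' (by simpa using hr)
    obtain ⟨s, hs, hsr⟩ := Nat.exists_prime_and_dvd hr1
    have hdvd : 2 * q * s ∣ Nat.card G := hr ▸ mul_dvd_mul_left _ hsr
    by_cases hs2 : s = 2
    · subst hs2
      have := hdiv 4 q (Dvd.dvd.trans ⟨q, by ring⟩ hdvd) (Dvd.dvd.trans ⟨4, by ring⟩ hdvd)
        (fun h4 => Nat.not_even_iff_odd.2 hqodd (even_iff_two_dvd.2 (dvd_trans ⟨2, rfl⟩ h4)))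
        (fun h4 => hq2 ((Nat.prime_dvd_prime_iff_eq hq Nat.prime_two).1
          (hq.dvd_of_dvd_pow (n := 2) h4)))
      omega
    · have h2s : ¬ 2 ∣ q * s := by
        rw [Nat.prime_two.dvd_mul, Nat.prime_dvd_prime_iff_eq Nat.prime_two hq,
          Nat.prime_dvd_prime_iff_eq Nat.prime_two hs]
        omega
      have := hdiv (2 * q) (q * s) (Dvd.dvd.trans ⟨s, by ring⟩ hdvd)
        (Dvd.dvd.trans ⟨2, by ring⟩ hdvd) (fun h4 => h2s ((Dvd.intro _ rfl).trans h4))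
        (fun h4 => by
          rw [mul_comm 2 q, Nat.mul_dvd_mul_iff_left hq.pos,
            Nat.prime_dvd_prime_iff_eq hs Nat.prime_two] at h4
          exact hs2 h4)
      rcases this with h5 | h5
      · exact hq.one_lt.ne' (by omega)
      · exact h2s (h5 ▸ dvd_rfl)
  exact ⟨q, hq, hqodd, ⟨mulEquivOfCyclicCardEq (by rw [hn, Nat.card_congr Multiplicative.toAdd, Nat.card_zmod])⟩⟩

theorem lambdaNumber_powerGraph_add_five_le [Finite G]
    (hG : ¬ (IsCyclic G ∧ ∃ p k : ℕ, p.Prime ∧ Nat.card G = p ^ k))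
    (hklein : ¬ Nonempty (G ≃* Multiplicative (ZMod 2 × ZMod 2)))
    (hcyc : ¬ ∃ q : ℕ, q.Prime ∧ Odd q ∧ Nonempty (G ≃* Multiplicative (ZMod (2 * q)))) :
    lambdaNumber (powerGraph G) + 5 ≤ 2 * Nat.card G := by
  by_contra hcon
  have hcov : ∀ u v : G, u ≠ v → ¬ (powerGraph G).Adj u v → orderOf u = 2 ∨ orderOf v = 2 := by
    intro u v hne h
    by_contra! h2
    exact hcon (lambdaNumber_powerGraph_add_five_le_of_not_adj hne h h2.1 h2.2)
  have huniq : ∀ x y : G, orderOf x = 2 → orderOf y = 2 → x = y := by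
    intro x y hx hy
    by_contra hne
    obtain ⟨z, hz, hzx, hzy⟩ := exists_third_of_orderOf_eq_two hx hy hne
    have := isKleinFour_of_orderOf_eq_two hx hy hz hne hzx.symm hzy.symm fun g => by
      by_contra! hg
      exact hcon (lambdaNumber_powerGraph_add_five_le_of_orderOf_eq_two hx hy hz hne hzx.symm
        hzy.symm hg.1 hg.2.1 hg.2.2.1 hg.2.2.2)
    exact hklein IsKleinFour.nonempty_mulEquiv
  obtain ⟨x, y, hne, h⟩ := exists_not_adj hG
  rcases hcov x y hne h with hx | hy
  · exact hcyc (exists_mulEquiv_of_unique_orderOf_eq_two hx (fun w hw => huniq w x hw hx) hne h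
      hcov)
  · exact hcyc (exists_mulEquiv_of_unique_orderOf_eq_two hy (fun w hw => huniq w y hw hy) hne.symm
      (fun h' => h h'.symm) hcov)

/-! ### Lower bounds for the extremal groups -/

theorem four_le_lambdaNumber_powerGraph [Finite G] (h : Nat.card G = 4) :
    4 ≤ lambdaNumber (powerGraph G) :=
  h ▸ card_le_lambdaNumber_of_dominating (powerGraph G) (e := 1)
    (fun _ hv => powerGraph_adj_one hv) (by omega)

theorem two_mul_card_le_lambdaNumber_powerGraph [Finite G] [IsCyclic G] {q : ℕ} (hq : q.Prime)
    (h : Nat.card G = 2 * q) : 2 * Nat.card G ≤ lambdaNumber (powerGraph G) + 4 := by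
  have := Fact.mk Nat.prime_two
  obtain ⟨z, hz⟩ := exists_prime_orderOf_dvd_card' (G := G) 2 ⟨q, h⟩
  refine two_mul_card_le_lambdaNumber_of_cover (powerGraph G) (e := 1) (z := z)
    (fun _ hv => powerGraph_adj_one hv) fun u v hne hadj => ?_
  have huv : ¬ orderOf u ∣ orderOf v := fun hd =>
    hadj (powerGraph_adj_iff.2 ⟨hne, Or.inr (mem_zpowers_of_orderOf_dvd hd)⟩)
  have hvu : ¬ orderOf v ∣ orderOf u := fun hd =>
    hadj (powerGraph_adj_iff.2 ⟨hne, Or.inl (mem_zpowers_of_orderOf_dvd hd)⟩)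
  have hdiv : ∀ w : G, orderOf w = 1 ∨ orderOf w = 2 ∨ orderOf w = q ∨ orderOf w = 2 * q := by
    intro w
    have hw := h ▸ orderOf_dvd_natCard w
    obtain ⟨a, b, ha, hb, hab⟩ := Nat.dvd_mul.1 hw
    rw [Nat.dvd_prime Nat.prime_two] at ha
    rw [Nat.dvd_prime hq] at hb
    rw [← hab]
    rcases ha with rfl | rfl <;> rcases hb with rfl | rfl <;> simp
  -- Among `1, 2, q, 2 * q` only `2` and `q` can be incomparable under divisibility.
  have key : orderOf u = 2 ∨ orderOf v = 2 := by
    rcases hdiv u with hu | hu | hu | hu <;> rcases hdiv v with hv | hv | hv | hv <;>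
      simp_all
  exact key.imp (fun hu => IsCyclic.eq_of_orderOf_eq_two hu hz)
    (fun hv => IsCyclic.eq_of_orderOf_eq_two hv hz)

end PowerGraph

end LambdaNumber

theorem theorem4p1 (G : Type*) [Group G] [Finite G]
    (hG : ¬ (IsCyclic G ∧ ∃ p k : ℕ, p.Prime ∧ Nat.card G = p ^ k)) :
    (LambdaNumber.lambdaNumber (LambdaNumber.powerGraph G) : ℤ) ≤ 2 * (Nat.card G : ℤ) - 4 ∧
    ((LambdaNumber.lambdaNumber (LambdaNumber.powerGraph G) : ℤ) = 2 * (Nat.card G : ℤ) - 4 ↔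
      (Nonempty (G ≃* Multiplicative (ZMod 2 × ZMod 2)) ∨
        ∃ q : ℕ, q.Prime ∧ Odd q ∧ Nonempty (G ≃* Multiplicative (ZMod (2 * q))))) := by
  have hle := LambdaNumber.lambdaNumber_powerGraph_add_four_le hG
  refine ⟨by omega, fun heq => ?_, ?_⟩
  · by_contra! h
    have := LambdaNumber.lambdaNumber_powerGraph_add_five_le hG (not_nonempty_iff.2 h.1) (by
      rintro ⟨q, hq, hodd, ⟨e⟩⟩
      exact (h.2 q hq hodd).false e)
    omega
  · rintro (⟨⟨e⟩⟩ | ⟨q, hq, -, ⟨e⟩⟩)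
    · have h4 : Nat.card G = 4 := by
        rw [Nat.card_congr e.toEquiv]
        simp
      have := LambdaNumber.four_le_lambdaNumber_powerGraph h4
      omega
    · have hcard : Nat.card G = 2 * q := by
        rw [Nat.card_congr e.toEquiv, Nat.card_congr Multiplicative.toAdd, Nat.card_zmod]
      have : IsCyclic G := isCyclic_of_surjective e.symm e.symm.surjective
      have := LambdaNumber.two_mul_card_le_lambdaNumber_powerGraph hq hcard
      omega
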